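/- Consider a stochastic bandit with $K\ge 2$ arms. In round $t$ the true reward $r_t(i)\in[0,1]$ of arm $i$ has a law that depends only on $i$, with mean $\mu_i$, and all the rewards $r_t(i)$ are independent. The optimal arm $i^*=\operatorname{argmax}_i\mu_i$ is unique, and $\Delta(i)=\mu_{i^*}-\mu_i$. In each round $t$ the learner selects an arm $i_t$ and may verify the round. An attacker adds to the reward $r_t(i_t)$ a contamination $\epsilon_t$, which is a function (possibly random) of $i_1,\dots,i_t$ and $r_1(i_1),\dots,r_t(i_t)$ with $r_t(i_t)+\epsilon_t\in[0,1]$. The learner observes $r^o_t=r_t(i_t)$ if the round is verified, and $r^o_t=r_t(i_t)+\epsilon_t$ otherwise. Secure-UCB with horizon $T$ maintains for each arm a count $N_t(i)$ and a mean $\hat\mu_t(i)$, both initially $0$. In round $t\le K$ it selects arm $t$ and verifies. In round $t>K$ it selects $$i_t\in\operatorname{argmax}_{i}\Big(\hat\mu_{t-1}(i)+\sqrt{400\log T/N_{t-1}(i)}\Big),$$ and verifies if and only if $N_{t-1}(i_t)\le 1200\log T/(\hat\Delta^*_{t-1})^2$ (the right side is $+\infty$ if $\hat\Delta^*_{t-1}=0$).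 Here $$\hat\Delta^*_t=\max\Big\{0,\ \hat\mu_t(a^*_t)-\sqrt{3\log T/N_t(a^*_t)}-\hat\mu_t(\tilde a_t)-\sqrt{3\log T/N_t(\tilde a_t)}\Big\},$$ where $a^*_t$ maximizes $\hat\mu_t(a)-\sqrt{3\log T/N_t(a)}$ over all arms $a$, and $\tilde a_t$ maximizes $\hat\mu_t(a)+\sqrt{3\log T/N_t(a)}$ over the arms $a\ne a^*_t$. Ties are broken by an arbitrary fixed rule, which may depend on the round. After a verified round, $N_t(i_t)=N_{t-1}(i_t)+1$ and $\hat\mu_t(i_t)=\big(\hat\mu_{t-1}(i_t)N_{t-1}(i_t)+r^o_t\big)/\big(N_{t-1}(i_t)+1\big)$. All other counts and means stay unchanged, and an unverified round changes nothing. **Theorem.** There are numerical constants $c_2,c_3,c_4>0$ such that for every such bandit, every strategy of the attacker and every integer $T\ge2$ with $T\ge c_2\log T/\min_{i\ne i^*}\Delta^2(i)$ the following holds. Let $N^s_T(i)$ be the number of verified rounds $t\le T$ with $i_t=i$. Then $$\sum_{i\in[K]}\mathbb E[N^s_T(i)]\le c_3\sum_{i\ne i^*}\frac{\log T}{\Delta^2(i)},$$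 and the regret $R(T)=T\mu_{i^*}-\mathbb E\big[\sum_{t=1}^T r_t(i_t)\big]$ satisfies $$R(T)\le c_4\sum_{i\ne i^*}\frac{\log T}{\Delta(i)}.$$ -/

import Mathlib

open MeasureTheory ProbabilityTheory Set

noncomputable section

/-! Rounds are numbered from `0`: round `t + 1` of a run with horizon `T` is index `t`, and the
indices of a run are `0, …, T - 1`. Arms are the elements of `Fin K`. -/

/-- The stochastic rewards of a bandit with arms `Fin K`: `r t i` is the true reward of arm `i` in
round `t`. All these rewards are independent, `r t i` has law `ν i` for every `t`, and rewards lie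
in `[0, 1]`. -/
structure IsStochasticBandit {Ω : Type*} [MeasurableSpace Ω] (P : Measure Ω) {K : ℕ}
    (ν : Fin K → Measure ℝ) (r : ℕ → Fin K → Ω → ℝ) : Prop where
  measurable : ∀ t i, Measurable (r t i)
  indep : iIndepFun (fun p : ℕ × Fin K => r p.1 p.2) P
  law : ∀ t i, P.map (r t i) = ν i
  bounded : ∀ i, ∀ᵐ x ∂(ν i), x ∈ Icc (0 : ℝ) 1

/-- The expected reward of arm `i`. -/
def meanReward {K : ℕ} (ν : Fin K → Measure ℝ) (i : Fin K) : ℝ := ∫ x, x ∂(ν i)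

/-- The gap `Δ(i)` of arm `i` with respect to the arm `best`. -/
def gap {K : ℕ} (ν : Fin K → Measure ℝ) (best i : Fin K) : ℝ :=
  meanReward ν best - meanReward ν i

/-- The arm `best` is the unique optimal arm. -/
def IsUniqueBest {K : ℕ} (ν : Fin K → Measure ℝ) (best : Fin K) : Prop :=
  ∀ i, i ≠ best → meanReward ν i < meanReward ν best

/-- A strategy of the attacker: from the arms selected so far and their true rewards (a list of
pairs, the current round at the head) it computes the contamination that it adds to the current
reward. The contaminated reward has to stay in `[0, 1]`. -/
structure AttackStrategy (K : ℕ) where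
  contamination : List (Fin K × ℝ) → ℝ
  mem_Icc : ∀ (i : Fin K) (x : ℝ) (h : List (Fin K × ℝ)), x ∈ Icc (0 : ℝ) 1 →
    x + contamination ((i, x) :: h) ∈ Icc (0 : ℝ) 1

/-- A rule that resolves ties in an argmax: in each round it picks an element of every nonempty
set of arms. -/
structure TieBreak (K : ℕ) where
  pick : ℕ → Finset (Fin K) → Fin K
  pick_mem : ∀ t (S : Finset (Fin K)), S.Nonempty → pick t S ∈ S

/-- The set of maximizers of `f` on `S`. -/
def argmaxOn {K : ℕ} (S : Finset (Fin K)) (f : Fin K → ℝ) : Finset (Fin K) := by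
  classical exact S.filter fun i => ∀ j ∈ S, f j ≤ f i

namespace SecureUCB

/-- What is known between two rounds: for each arm, the number `N(i)` of (verified) rewards that
the learner has used and their empirical mean; and the past selected arms with their true rewards,
which only the attacker uses. -/
structure State (K : ℕ) where
  count : Fin K → ℕ
  mean : Fin K → ℝ
  history : List (Fin K × ℝ)

variable {K : ℕ}

/-- The state before the first round. -/
def init : State K := ⟨fun _ => 0, fun _ => 0, []⟩

/-- Lower confidence bound in the gap estimate. -/
def lcb (T : ℕ) (s : State K) (i : Fin K) : ℝ := s.mean i - √(3 * Real.log T / s.count i)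

/-- Upper confidence bound in the gap estimate. -/
def ucb (T : ℕ) (s : State K) (i : Fin K) : ℝ := s.mean i + √(3 * Real.log T / s.count i)

/-- Upper confidence bound by which arms are selected. -/
def selectionIndex (T : ℕ) (s : State K) (i : Fin K) : ℝ :=
  s.mean i + √(400 * Real.log T / s.count i)

/-- The arm with the largest lower confidence bound. -/
def leader (tie : TieBreak K) (T t : ℕ) (s : State K) : Fin K :=
  tie.pick t (argmaxOn Finset.univ (lcb T s))

/-- The arm with the largest upper confidence bound among all arms but the leader. -/
def runnerUp (tie : TieBreak K) (T t : ℕ) (s : State K) : Fin K :=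
  tie.pick t (argmaxOn (Finset.univ.erase (leader tie T t s)) (ucb T s))

/-- The estimate of the smallest gap. Its value does not depend on how ties are resolved, hence it
changes only when the counts and means do. -/
def gapEstimate (tie : TieBreak K) (T t : ℕ) (s : State K) : ℝ :=
  max 0 (lcb T s (leader tie T t s) - ucb T s (runnerUp tie T t s))

/-- The arm selected in round `t`: round robin in the first `K` rounds, then an arm with the
largest index. -/
def select (tie : TieBreak K) (T t : ℕ) (s : State K) : Fin K :=
  if h : t < K then ⟨t, h⟩ else tie.pick t (argmaxOn Finset.univ (selectionIndex T s))

/-- The criterion for verification: always in the first `K` rounds, and later if the number of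
verified rewards of the selected arm is at most `1200 log T / gapEstimate ^ 2`. This bound is read
as infinite if the gap estimate is `0`. -/
def Verify (tie : TieBreak K) (T t : ℕ) (s : State K) : Prop :=
  t < K ∨ gapEstimate tie T t s = 0 ∨
    (s.count (select tie T t s) : ℝ) ≤ 1200 * Real.log T / gapEstimate tie T t s ^ 2

open Classical in
/-- The reward that the learner observes in round `t`: the true one if the round is verified, the
contaminated one otherwise. Here `x i` is the true reward of arm `i` in that round. -/
def observed (tie : TieBreak K) (A : AttackStrategy K) (T t : ℕ) (x : Fin K → ℝ)
    (s : State K) : ℝ :=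
  let i := select tie T t s
  if Verify tie T t s then x i else x i + A.contamination ((i, x i) :: s.history)

open Classical in
/-- The state after round `t`. -/
def step (tie : TieBreak K) (A : AttackStrategy K) (T t : ℕ) (x : Fin K → ℝ)
    (s : State K) : State K :=
  let i := select tie T t s
  if Verify tie T t s then
    { count := Function.update s.count i (s.count i + 1)
      mean := Function.update s.mean i
        ((s.mean i * s.count i + observed tie A T t x s) / (s.count i + 1))
      history := (i, x i) :: s.history }
  else
    { count := s.count
      mean := s.mean
      history := (i, x i) :: s.history }

/-- The state before round `t` (after `t` rounds), when `x n i` is the true reward of arm `i` in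
round `n`. -/
def run (tie : TieBreak K) (A : AttackStrategy K) (T : ℕ) (x : ℕ → Fin K → ℝ) : ℕ → State K
  | 0 => init
  | t + 1 => step tie A T t (x t) (run tie A T x t)

/-- The arm `i_t` selected in round `t`. -/
def action (tie : TieBreak K) (A : AttackStrategy K) (T : ℕ) (x : ℕ → Fin K → ℝ) (t : ℕ) :
    Fin K :=
  select tie T t (run tie A T x t)

open Classical in
/-- The number of verifications of arm `i` within the horizon. -/
def numVerifications (tie : TieBreak K) (A : AttackStrategy K) (T : ℕ) (x : ℕ → Fin K → ℝ)
    (i : Fin K) : ℕ :=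
  ((Finset.range T).filter fun t =>
    action tie A T x t = i ∧ Verify tie T t (run tie A T x t)).card

/-- The sum of the true rewards of the selected arms within the horizon. -/
def totalReward (tie : TieBreak K) (A : AttackStrategy K) (T : ℕ) (x : ℕ → Fin K → ℝ) : ℝ :=
  ∑ t ∈ Finset.range T, x t (action tie A T x t)

end SecureUCB

end

/-! Counts and means change only in verified rounds, and then by true rewards. The contamination
therefore never reaches them, and the selected arm and the decision to verify depend on past true
rewards alone. What remains is a UCB analysis in which some rounds yield no sample.

Let L = log T, and suppose that all empirical means are within √(3L/N) of the true ones. The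
selection radius 20√(L/N) is much larger than this error. A selected suboptimal arm `a` thus has
N(a)Δ(a)² ≤ 484 L (`Concentrated.count_mul_gap_sq_le`). The gap estimate never exceeds the smallest
gap, so such a round passes the test with threshold 1200 L (`Concentrated.verify_of_select_ne`).
Pulls of suboptimal arms are thus all counted, which bounds regret as well as verifications. For the
optimal arm, the wide selection radius forces the other arms to be well sampled by the time it is
selected with a large count. The gap estimate is then at least half the smallest gap, and
verification stops (`Concentrated.count_best_mul_gap_sq_le`).

Concentration fails with probability at most 2K/T⁴, by an exponential supermartingale and a union
bound (`lintegral_exp_run_le_one`, `measureReal_not_concentrated_le`). On failure the trivial bound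
T is used. -/

theorem mem_argmaxOn {K : ℕ} {S : Finset (Fin K)} {f : Fin K → ℝ} {i : Fin K} :
    i ∈ argmaxOn S f ↔ i ∈ S ∧ ∀ j ∈ S, f j ≤ f i := by
  classical
  simp [argmaxOn]

theorem argmaxOn_nonempty {K : ℕ} {S : Finset (Fin K)} (hS : S.Nonempty) (f : Fin K → ℝ) :
    (argmaxOn S f).Nonempty := by
  obtain ⟨i, hi, h⟩ := S.exists_max_image f hS
  exact ⟨i, mem_argmaxOn.2 ⟨hi, h⟩⟩

theorem pick_argmaxOn_spec {K : ℕ} (tie : TieBreak K) (t : ℕ) {S : Finset (Fin K)}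
    (hS : S.Nonempty) (f : Fin K → ℝ) :
    tie.pick t (argmaxOn S f) ∈ S ∧ ∀ j ∈ S, f j ≤ f (tie.pick t (argmaxOn S f)) :=
  mem_argmaxOn.1 (tie.pick_mem t _ (argmaxOn_nonempty hS f))

theorem meanReward_le_best {K : ℕ} {ν : Fin K → Measure ℝ} {best : Fin K}
    (hb : IsUniqueBest ν best) (i : Fin K) : meanReward ν i ≤ meanReward ν best := by
  by_cases h : i = best
  · rw [h]
  · exact (hb i h).le

theorem gap_nonneg {K : ℕ} {ν : Fin K → Measure ℝ} {best : Fin K}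
    (hb : IsUniqueBest ν best) (i : Fin K) : 0 ≤ gap ν best i :=
  sub_nonneg.2 (meanReward_le_best hb i)

theorem gap_pos {K : ℕ} {ν : Fin K → Measure ℝ} {best : Fin K}
    (hb : IsUniqueBest ν best) {i : Fin K} (hi : i ≠ best) : 0 < gap ν best i :=
  sub_pos.2 (hb i hi)

theorem gap_self {K : ℕ} (ν : Fin K → Measure ℝ) (best : Fin K) : gap ν best best = 0 :=
  sub_self _

/-! ### Deterministic consequences of concentration in a single state -/

namespace SecureUCB

variable {K : ℕ}

/-- Every empirical mean that is based on at least one reward lies within the confidence radius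
of the gap estimate around the true mean. -/
def Concentrated (T : ℕ) (m : Fin K → ℝ) (s : State K) : Prop :=
  ∀ i, 0 < s.count i → |s.mean i - m i| ≤ √(3 * Real.log T / s.count i)

/-- Since √3 < 7/4, all radii become rational multiples of √(L/N), which linear arithmetic can
compare. -/
theorem sqrt_three_mul_le (a n : ℝ) : √(3 * a / n) ≤ 7 / 4 * √(a / n) := by
  rw [mul_div_assoc, Real.sqrt_mul (by norm_num)]
  gcongr
  rw [Real.sqrt_le_left (by norm_num)]
  norm_num

theorem sqrt_four_hundred_mul (a n : ℝ) : √(400 * a / n) = 20 * √(a / n) := by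
  rw [mul_div_assoc, Real.sqrt_mul (by norm_num)]
  congr 1
  rw [Real.sqrt_eq_iff_mul_self_eq] <;> norm_num

theorem sq_mul_le_of_le_mul_sqrt {d c a n : ℝ} (ha : 0 ≤ a) (hn : 0 < n) (hd : 0 ≤ d)
    (h : d ≤ c * √(a / n)) : n * d ^ 2 ≤ c ^ 2 * a := by
  have h1 : d ^ 2 ≤ (c * √(a / n)) ^ 2 := by gcongr
  rw [mul_pow, Real.sq_sqrt (by positivity)] at h1
  calc n * d ^ 2 ≤ n * (c ^ 2 * (a / n)) := by gcongr
    _ = c ^ 2 * a := by field_simp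

section Deterministic

variable {ν : Fin K → Measure ℝ} {best : Fin K} (tie : TieBreak K) {T t : ℕ} {s : State K}

theorem Concentrated.lcb_le (hs : Concentrated T (meanReward ν) s) {i : Fin K}
    (hi : 0 < s.count i) : lcb T s i ≤ meanReward ν i := by
  have := abs_le.1 (hs i hi)
  unfold lcb
  linarith

theorem Concentrated.le_ucb (hs : Concentrated T (meanReward ν) s) {i : Fin K}
    (hi : 0 < s.count i) : meanReward ν i ≤ ucb T s i := by
  have := abs_le.1 (hs i hi)
  unfold ucb
  linarith

theorem Concentrated.le_lcb (hs : Concentrated T (meanReward ν) s) {i : Fin K}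
    (hi : 0 < s.count i) :
    meanReward ν i - 7 / 2 * √(Real.log T / s.count i) ≤ lcb T s i := by
  have := abs_le.1 (hs i hi)
  have := sqrt_three_mul_le (Real.log T) (s.count i)
  unfold lcb
  linarith

theorem Concentrated.ucb_le (hs : Concentrated T (meanReward ν) s) {i : Fin K}
    (hi : 0 < s.count i) :
    ucb T s i ≤ meanReward ν i + 7 / 2 * √(Real.log T / s.count i) := by
  have := abs_le.1 (hs i hi)
  have := sqrt_three_mul_le (Real.log T) (s.count i)
  unfold ucb
  linarith

theorem Concentrated.selectionIndex_le (hs : Concentrated T (meanReward ν) s) {i : Fin K}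
    (hi : 0 < s.count i) :
    selectionIndex T s i ≤ meanReward ν i + 87 / 4 * √(Real.log T / s.count i) := by
  have := abs_le.1 (hs i hi)
  have := sqrt_three_mul_le (Real.log T) (s.count i)
  unfold selectionIndex
  rw [sqrt_four_hundred_mul]
  linarith

theorem Concentrated.le_selectionIndex (hs : Concentrated T (meanReward ν) s) {i : Fin K}
    (hi : 0 < s.count i) :
    meanReward ν i + 73 / 4 * √(Real.log T / s.count i) ≤ selectionIndex T s i := by
  have := abs_le.1 (hs i hi)
  have := sqrt_three_mul_le (Real.log T) (s.count i)
  unfold selectionIndex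
  rw [sqrt_four_hundred_mul]
  linarith

theorem lcb_le_lcb_leader (i : Fin K) : lcb T s i ≤ lcb T s (leader tie T t s) :=
  (pick_argmaxOn_spec tie t ⟨i, Finset.mem_univ i⟩ (lcb T s)).2 i (Finset.mem_univ i)

theorem runnerUp_spec {i : Fin K} (hi : i ≠ leader tie T t s) :
    runnerUp tie T t s ≠ leader tie T t s ∧ ucb T s i ≤ ucb T s (runnerUp tie T t s) := by
  have hmem : i ∈ Finset.univ.erase (leader tie T t s) := by simp [hi]
  have := pick_argmaxOn_spec tie t ⟨i, hmem⟩ (ucb T s)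
  exact ⟨(Finset.mem_erase.1 this.1).1, this.2 i hmem⟩

theorem selectionIndex_le_select (ht : K ≤ t) (i : Fin K) :
    selectionIndex T s i ≤ selectionIndex T s (select tie T t s) := by
  rw [select, dif_neg ht.not_gt]
  exact (pick_argmaxOn_spec tie t ⟨i, Finset.mem_univ i⟩ (selectionIndex T s)).2 i
    (Finset.mem_univ i)

/-- If the leader is optimal, the runner-up's upper bound is at least the mean of `i`. Otherwise it
is at least the optimal mean, and the difference of the bounds is not positive. -/
theorem Concentrated.gapEstimate_le (hb : IsUniqueBest ν best)
    (hs : Concentrated T (meanReward ν) s) (hpos : ∀ i, 0 < s.count i) {i : Fin K}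
    (hi : i ≠ best) : gapEstimate tie T t s ≤ gap ν best i := by
  refine max_le (gap_nonneg hb i) ?_
  have h1 := hs.lcb_le (hpos (leader tie T t s))
  by_cases hl : leader tie T t s = best
  · have h2 := (runnerUp_spec tie (T := T) (t := t) (s := s) (i := i) (by rwa [hl])).2
    have h3 := hs.le_ucb (hpos i)
    rw [hl] at h1 ⊢
    unfold gap
    linarith
  · have h2 := (runnerUp_spec tie (T := T) (t := t) (s := s) (i := best) (Ne.symm hl)).2
    have h3 := hs.le_ucb (hpos best)
    have h4 := meanReward_le_best hb (leader tie T t s)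
    have h5 := gap_nonneg hb i
    linarith

theorem Concentrated.count_mul_gap_sq_le (hb : IsUniqueBest ν best) (hT : 1 ≤ T)
    (hs : Concentrated T (meanReward ν) s) (hpos : ∀ i, 0 < s.count i) (ht : K ≤ t) :
    s.count (select tie T t s) * gap ν best (select tie T t s) ^ 2 ≤ 484 * Real.log T := by
  set a := select tie T t s with ha
  have h1 := hs.selectionIndex_le (hpos a)
  have h2 := hs.le_selectionIndex (hpos best)
  have h3 : selectionIndex T s best ≤ selectionIndex T s a := selectionIndex_le_select tie ht best
  have h4 := Real.sqrt_nonneg (Real.log T / s.count best)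
  have h5 := Real.sqrt_nonneg (Real.log T / s.count a)
  -- The factor 87/4 is rounded up to 22, and 22² = 484.
  have h6 : gap ν best a ≤ 22 * √(Real.log T / s.count a) := by
    unfold gap
    linarith
  have := sq_mul_le_of_le_mul_sqrt (Real.log_nonneg (by exact_mod_cast hT))
    (by exact_mod_cast hpos a) (gap_nonneg hb a) h6
  linarith

/-- The estimate is at most the gap of the selected arm, whose count is at most 484 L/Δ², below the
threshold 1200 L/Δ². The attacker can only contaminate pulls of the optimal arm. -/
theorem Concentrated.verify_of_select_ne (hb : IsUniqueBest ν best) (hT : 1 ≤ T)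
    (hs : Concentrated T (meanReward ν) s) (hpos : ∀ i, 0 < s.count i) (ht : K ≤ t)
    (ha : select tie T t s ≠ best) : Verify tie T t s := by
  by_cases h0 : gapEstimate tie T t s = 0
  · exact Or.inr (Or.inl h0)
  refine Or.inr (Or.inr ?_)
  have h1 := hs.count_mul_gap_sq_le tie hb hT hpos ht
  have h2 := hs.gapEstimate_le tie (t := t) hb hpos ha
  have h3 : 0 < gapEstimate tie T t s := lt_of_le_of_ne (le_max_left _ _) (Ne.symm h0)
  have h4 : 0 ≤ Real.log T := Real.log_nonneg (by exact_mod_cast hT)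
  rw [le_div_iff₀ (by positivity)]
  calc (s.count (select tie T t s) : ℝ) * gapEstimate tie T t s ^ 2
      ≤ s.count (select tie T t s) * gap ν best (select tie T t s) ^ 2 := by gcongr
    _ ≤ 1200 * Real.log T := by linarith

/-- Selecting the optimal arm with a small radius means that the index of every other arm is low,
hence that its radius is small compared with its own gap. The bounds in the gap estimate then
separate. -/
theorem Concentrated.half_gap_le_gapEstimate (hb : IsUniqueBest ν best)
    (hs : Concentrated T (meanReward ν) s) (hpos : ∀ i, 0 < s.count i) (ht : K ≤ t)
    {j : Fin K} (hj : j ≠ best) (hmin : ∀ i, i ≠ best → gap ν best j ≤ gap ν best i)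
    (ha : select tie T t s = best)
    (hw : 44 * √(Real.log T / s.count best) ≤ gap ν best j) :
    gap ν best j / 2 ≤ gapEstimate tie T t s := by
  have hjpos := gap_pos hb hj
  -- Comparing indices gives (73/4)√(L/N(i)) ≤ Δ(i) + (87/4)Δ(j)/44, so (7/2)√(L/N(i)) < 0.3 Δ(i).
  -- The lower bound of `best` loses at most (7/2)Δ(j)/44 < 0.1 Δ(j).
  have hucb : ∀ i, i ≠ best → ucb T s i ≤ meanReward ν best - 7 / 10 * gap ν best i := by
    intro i hi
    have h1 := hs.selectionIndex_le (hpos best)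
    have h2 := hs.le_selectionIndex (hpos i)
    have h3 := selectionIndex_le_select tie (T := T) (s := s) ht i
    rw [ha] at h3
    have h4 := hs.ucb_le (hpos i)
    have h5 := hmin i hi
    have h6 : gap ν best i = meanReward ν best - meanReward ν i := rfl
    linarith
  have hlcb := hs.le_lcb (hpos best)
  have hlead : leader tie T t s = best := by
    by_contra hl
    have h1 := hucb _ hl
    have h2 := lcb_le_lcb_leader tie (T := T) (t := t) (s := s) best
    have h3 := hmin _ hl
    have h4 : lcb T s (leader tie T t s) ≤ ucb T s (leader tie T t s) := by
      have := Real.sqrt_nonneg (3 * Real.log T / s.count (leader tie T t s))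
      unfold lcb ucb
      linarith
    linarith
  have hr := (runnerUp_spec tie (T := T) (t := t) (s := s) (i := j) (by rwa [hlead])).1
  rw [hlead] at hr
  refine le_trans ?_ (le_max_right _ _)
  have h1 := hucb _ hr
  have h2 := hmin _ hr
  rw [hlead]
  linarith

theorem Concentrated.count_best_mul_gap_sq_le (hb : IsUniqueBest ν best) (hT : 1 ≤ T)
    (hs : Concentrated T (meanReward ν) s) (hpos : ∀ i, 0 < s.count i) (ht : K ≤ t)
    {j : Fin K} (hj : j ≠ best) (hmin : ∀ i, i ≠ best → gap ν best j ≤ gap ν best i)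
    (ha : select tie T t s = best) (hv : Verify tie T t s) :
    s.count best * gap ν best j ^ 2 ≤ 4800 * Real.log T := by
  have hL : 0 ≤ Real.log T := Real.log_nonneg (by exact_mod_cast hT)
  have hjpos := gap_pos hb hj
  by_cases hw : 44 * √(Real.log T / s.count best) ≤ gap ν best j
  · have h1 := hs.half_gap_le_gapEstimate tie hb hpos ht hj hmin ha hw
    have h2 : 0 < gapEstimate tie T t s := by linarith
    rcases hv with hv | hv | hv
    · omega
    · exact absurd hv h2.ne'
    · rw [ha, le_div_iff₀ (by positivity)] at hv
      have h3 : (gap ν best j / 2) ^ 2 ≤ gapEstimate tie T t s ^ 2 := by gcongr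
      have h4 : (s.count best : ℝ) * (gap ν best j / 2) ^ 2
          ≤ s.count best * gapEstimate tie T t s ^ 2 := by gcongr
      nlinarith
  -- Few samples: 44² = 1936 < 4800. The other case has threshold 1200 L/(Δ(j)/2)² = 4800 L/Δ(j)².
  · have := sq_mul_le_of_le_mul_sqrt hL (by exact_mod_cast hpos best) hjpos.le (not_le.1 hw).le
    linarith

end Deterministic

/-! ### Counts and regret along a run -/

section Run

variable (tie : TieBreak K) (A : AttackStrategy K) (T : ℕ) (x : ℕ → Fin K → ℝ)

open Classical in
theorem count_run_succ (t : ℕ) (i : Fin K) :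
    (run tie A T x (t + 1)).count i = (run tie A T x t).count i +
      if action tie A T x t = i ∧ Verify tie T t (run tie A T x t) then 1 else 0 := by
  by_cases hv : Verify tie T t (run tie A T x t)
  · by_cases hi : action tie A T x t = i
    · have hi' : select tie T t (run tie A T x t) = i := hi
      simp [run, step, hv, hi, hi']
    · have hi' : i ≠ select tie T t (run tie A T x t) := fun h => hi h.symm
      simp [run, step, hv, hi, Function.update_of_ne hi']
  · simp [run, step, hv]

open Classical in
-- Here the attacker drops out: a mean is updated only after verification, when the observed reward
-- is the true one.
theorem mean_run_succ (t : ℕ) (i : Fin K) :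
    (run tie A T x (t + 1)).mean i =
      if action tie A T x t = i ∧ Verify tie T t (run tie A T x t) then
        ((run tie A T x t).mean i * (run tie A T x t).count i + x t i) /
          ((run tie A T x t).count i + 1)
      else (run tie A T x t).mean i := by
  by_cases hv : Verify tie T t (run tie A T x t)
  · by_cases hi : action tie A T x t = i
    · have hi' : select tie T t (run tie A T x t) = i := hi
      simp [run, step, observed, hv, hi, hi']
    · have hi' : i ≠ select tie T t (run tie A T x t) := fun h => hi h.symm
      simp [run, step, hv, hi, Function.update_of_ne hi']
  · simp [run, step, hv]

theorem numVerifications_eq (i : Fin K) :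
    numVerifications tie A T x i = (run tie A T x T).count i := by
  classical
  have h : ∀ n, ((Finset.range n).filter fun t =>
      action tie A T x t = i ∧ Verify tie T t (run tie A T x t)).card
        = (run tie A T x n).count i := by
    intro n
    induction n with
    | zero => simp [run, init]
    | succ n ih =>
      rw [count_run_succ, ← ih, Finset.card_filter, Finset.card_filter, Finset.sum_range_succ]
  rw [← h, numVerifications]

theorem sum_count_run_le (n : ℕ) : ∑ i, (run tie A T x n).count i ≤ n := by
  classical
  induction n with
  | zero => simp [run, init]
  | succ n ih =>
    simp_rw [count_run_succ]
    rw [Finset.sum_add_distrib]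
    gcongr
    calc _ ≤ ∑ i, if action tie A T x n = i then 1 else 0 := by
          gcongr with i
          split_ifs with h1 h2 <;> simp_all
      _ = 1 := by simp

theorem count_run_le (n : ℕ) (i : Fin K) : (run tie A T x n).count i ≤ n :=
  (Finset.single_le_sum (f := (run tie A T x n).count) (fun _ _ => Nat.zero_le _)
    (Finset.mem_univ i)).trans (sum_count_run_le tie A T x n)

theorem count_run_le_succ (t : ℕ) (i : Fin K) :
    (run tie A T x t).count i ≤ (run tie A T x (t + 1)).count i := by
  rw [count_run_succ]
  omega

theorem count_run_of_le {n : ℕ} (hn : n ≤ K) (i : Fin K) :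
    (run tie A T x n).count i = if (i : ℕ) < n then 1 else 0 := by
  induction n with
  | zero => simp [run, init]
  | succ n ih =>
    have hK : n < K := hn
    have hv : Verify tie T n (run tie A T x n) := Or.inl hK
    have ha : action tie A T x n = ⟨n, hK⟩ := by simp [action, select, hK]
    rw [count_run_succ, ih hK.le, ha]
    simp only [hv, and_true, Fin.ext_iff]
    split_ifs <;> omega

theorem count_run_pos {n : ℕ} (hn : K ≤ n) (i : Fin K) : 0 < (run tie A T x n).count i := by
  induction n, hn using Nat.le_induction with
  | base => rw [count_run_of_le tie A T x le_rfl]; simp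
  | succ n _ ih => exact ih.trans_le (count_run_le_succ tie A T x n i)

section ConcentratedRun

variable {tie A T x} {ν : Fin K → Measure ℝ} {best : Fin K}

/-- After round robin, a count grows only from a value that obeys the one-state bound, so it
overshoots by at most one; this is the extra Δ². -/
theorem count_run_mul_gap_sq_le (hb : IsUniqueBest ν best) (hT : 1 ≤ T) {n : ℕ}
    (hs : ∀ t < n, Concentrated T (meanReward ν) (run tie A T x t)) {i : Fin K} :
    (run tie A T x n).count i * gap ν best i ^ 2 ≤ 484 * Real.log T + gap ν best i ^ 2 := by
  have hL : 0 ≤ Real.log T := Real.log_nonneg (by exact_mod_cast hT)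
  induction n with
  | zero => simp [run, init]; positivity
  | succ n ih =>
    specialize ih fun t ht => hs t (by omega)
    by_cases hK : n < K
    · rw [count_run_of_le tie A T x hK]
      have h2 := sq_nonneg (gap ν best i)
      split_ifs <;> push_cast <;> linarith
    rw [count_run_succ]
    split_ifs with h
    · have := (hs n (by omega)).count_mul_gap_sq_le tie hb hT
        (count_run_pos tie A T x (not_lt.1 hK)) (not_lt.1 hK)
      rw [show select tie T n (run tie A T x n) = i from h.1] at this
      push_cast
      linarith
    · simpa using ih

theorem count_run_best_mul_gap_sq_le (hb : IsUniqueBest ν best) (hT : 1 ≤ T) {n : ℕ}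
    (hs : ∀ t < n, Concentrated T (meanReward ν) (run tie A T x t)) {j : Fin K} (hj : j ≠ best)
    (hmin : ∀ i, i ≠ best → gap ν best j ≤ gap ν best i) :
    (run tie A T x n).count best * gap ν best j ^ 2
      ≤ 4800 * Real.log T + gap ν best j ^ 2 := by
  have hL : 0 ≤ Real.log T := Real.log_nonneg (by exact_mod_cast hT)
  induction n with
  | zero => simp [run, init]; positivity
  | succ n ih =>
    specialize ih fun t ht => hs t (by omega)
    by_cases hK : n < K
    · rw [count_run_of_le tie A T x hK]
      have h2 := sq_nonneg (gap ν best j)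
      split_ifs <;> push_cast <;> linarith
    rw [count_run_succ]
    split_ifs with h
    · have := (hs n (by omega)).count_best_mul_gap_sq_le tie hb hT
        (count_run_pos tie A T x (not_lt.1 hK)) (not_lt.1 hK) hj hmin h.1 h.2
      push_cast
      linarith
    · simpa using ih

/-- Every round with positive gap is verified, hence counted. -/
theorem sum_gap_action_le (hb : IsUniqueBest ν best) (hT : 1 ≤ T) {n : ℕ}
    (hs : ∀ t < n, Concentrated T (meanReward ν) (run tie A T x t)) :
    ∑ t ∈ Finset.range n, gap ν best (action tie A T x t)
      ≤ ∑ i, (run tie A T x n).count i * gap ν best i := by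
  classical
  induction n with
  | zero => simp [run, init]
  | succ n ih =>
    specialize ih fun t ht => hs t (by omega)
    rw [Finset.sum_range_succ]
    simp_rw [count_run_succ]
    push_cast
    simp_rw [add_mul]
    rw [Finset.sum_add_distrib]
    gcongr
    have hnn : ∀ i ∈ Finset.univ, 0 ≤
        (if action tie A T x n = i ∧ Verify tie T n (run tie A T x n) then (1 : ℝ) else 0)
          * gap ν best i := by
      intro i _
      have := gap_nonneg hb i
      positivity
    by_cases ha : action tie A T x n = best
    · rw [ha, gap_self]
      rw [ha] at hnn
      exact Finset.sum_nonneg hnn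
    have hv : Verify tie T n (run tie A T x n) := by
      by_cases hK : n < K
      · exact Or.inl hK
      · exact (hs n (by omega)).verify_of_select_ne tie hb hT
          (count_run_pos tie A T x (not_lt.1 hK)) (not_lt.1 hK) ha
    refine le_trans ?_ (Finset.single_le_sum hnn (Finset.mem_univ (action tie A T x n)))
    simp [hv]

end ConcentratedRun

end Run

end SecureUCB

/-! ### Measurability of the algorithm -/

section ArgmaxMeasurability

variable {Ω : Type*} [MeasurableSpace Ω] {K : ℕ}

theorem measurableSet_finset_pred {S : Ω → Finset (Fin K)}
    (hS : ∀ i, MeasurableSet {ω | i ∈ S ω}) (p : Finset (Fin K) → Prop) :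
    MeasurableSet {ω | p (S ω)} := by
  have h : {ω | p (S ω)} = ⋃ F ∈ {F | p F}, ⋂ i, {ω | i ∈ S ω ↔ i ∈ F} := by
    ext ω
    simp only [mem_ofPred_eq, mem_iUnion, mem_iInter, exists_prop]
    constructor
    · exact fun hω => ⟨S ω, hω, fun i => Iff.rfl⟩
    · rintro ⟨F, hF, h⟩
      rwa [Finset.ext h]
  rw [h]
  refine MeasurableSet.biUnion (Set.to_countable _) fun F _ => MeasurableSet.iInter fun i => ?_
  exact (hS i).iff (MeasurableSet.const _)

theorem measurableSet_mem_argmaxOn {S : Ω → Finset (Fin K)} {f : Fin K → Ω → ℝ}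
    (hS : ∀ i, MeasurableSet {ω | i ∈ S ω}) (hf : ∀ i, Measurable (f i)) (i : Fin K) :
    MeasurableSet {ω | i ∈ argmaxOn (S ω) fun j => f j ω} := by
  simp only [mem_argmaxOn]
  have h : {ω | ∀ j ∈ S ω, f j ω ≤ f i ω} = ⋂ j, {ω | j ∈ S ω → f j ω ≤ f i ω} := by
    ext ω
    simp
  have h' : MeasurableSet {ω | ∀ j ∈ S ω, f j ω ≤ f i ω} := by
    rw [h]
    exact MeasurableSet.iInter fun j => (hS j).imp (measurableSet_le (hf j) (hf i))
  exact (hS i).inter h'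

theorem measurable_pick_argmaxOn (tie : TieBreak K) (t : ℕ) {S : Ω → Finset (Fin K)}
    {f : Fin K → Ω → ℝ} (hS : ∀ i, MeasurableSet {ω | i ∈ S ω}) (hf : ∀ i, Measurable (f i)) :
    Measurable fun ω => tie.pick t (argmaxOn (S ω) fun j => f j ω) :=
  measurable_to_countable' fun i =>
    measurableSet_finset_pred (measurableSet_mem_argmaxOn hS hf) fun F => tie.pick t F = i

theorem measurable_apply_of_measurable {f : Fin K → Ω → ℝ} {l : Ω → Fin K}
    (hf : ∀ i, Measurable (f i)) (hl : Measurable l) : Measurable fun ω => f (l ω) ω := by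
  have h : Measurable fun p : Fin K × Ω => f p.1 p.2 := measurable_from_prod_countable_right hf
  exact h.comp (hl.prodMk measurable_id)

end ArgmaxMeasurability

namespace SecureUCB

section StateMeasurability

variable {Ω : Type*} [MeasurableSpace Ω] {K : ℕ} (tie : TieBreak K) (T t : ℕ) {s : Ω → State K}

variable (hc : ∀ i, Measurable fun ω => ((s ω).count i : ℝ))
  (hm : ∀ i, Measurable fun ω => (s ω).mean i)

include hc hm

theorem measurable_lcb (i : Fin K) : Measurable fun ω => lcb T (s ω) i :=
  (hm i).sub ((hc i).const_div _).sqrt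

theorem measurable_ucb (i : Fin K) : Measurable fun ω => ucb T (s ω) i :=
  (hm i).add ((hc i).const_div _).sqrt

theorem measurable_selectionIndex (i : Fin K) : Measurable fun ω => selectionIndex T (s ω) i :=
  (hm i).add ((hc i).const_div _).sqrt

theorem measurable_leader : Measurable fun ω => leader tie T t (s ω) :=
  measurable_pick_argmaxOn tie t (fun _ => MeasurableSet.const _) (measurable_lcb T hc hm)

theorem measurable_runnerUp : Measurable fun ω => runnerUp tie T t (s ω) := by
  refine measurable_pick_argmaxOn tie t (fun i => ?_) (measurable_ucb T hc hm)
  simp only [Finset.mem_erase, Finset.mem_univ, and_true]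
  exact (measurable_leader tie T t hc hm (measurableSet_singleton i)).compl.congr
    (by ext ω; simp [eq_comm])

theorem measurable_gapEstimate : Measurable fun ω => gapEstimate tie T t (s ω) :=
  measurable_const.max
    ((measurable_apply_of_measurable (measurable_lcb T hc hm)
      (measurable_leader tie T t hc hm)).sub
    (measurable_apply_of_measurable (measurable_ucb T hc hm)
      (measurable_runnerUp tie T t hc hm)))

theorem measurable_select : Measurable fun ω => select tie T t (s ω) := by
  unfold select
  split_ifs
  · exact measurable_const
  · exact measurable_pick_argmaxOn tie t (fun _ => MeasurableSet.const _)
      (measurable_selectionIndex T hc hm)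

theorem measurableSet_verify : MeasurableSet {ω | Verify tie T t (s ω)} := by
  have hg := measurable_gapEstimate tie T t hc hm
  refine (MeasurableSet.const _).union ((hg (measurableSet_singleton 0)).union ?_)
  exact measurableSet_le (measurable_apply_of_measurable hc (measurable_select tie T t hc hm))
    ((hg.pow_const 2).const_div _)

end StateMeasurability

section RunMeasurability

variable {Ω : Type*} [MeasurableSpace Ω] {K : ℕ} (tie : TieBreak K) (A : Ω → AttackStrategy K)
  (T : ℕ) {r : ℕ → Fin K → Ω → ℝ}

/-- No measurability in `ω` of the attacker is needed, since counts and means do not read the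
contamination. The σ-algebra is arbitrary, so that the one of past rewards can be inserted. -/
theorem measurable_count_mean_run {t : ℕ} (hr : ∀ s < t, ∀ j, Measurable (r s j)) :
    (∀ i, Measurable fun ω => ((run tie (A ω) T (fun n j => r n j ω) t).count i : ℝ)) ∧
    ∀ i, Measurable fun ω => (run tie (A ω) T (fun n j => r n j ω) t).mean i := by
  classical
  induction t with
  | zero => exact by simp [run, init]
  | succ t ih =>
    obtain ⟨hc, hm⟩ := ih fun s hs => hr s (by omega)
    have hB : ∀ i, MeasurableSet {ω | action tie (A ω) T (fun n j => r n j ω) t = i ∧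
        Verify tie T t (run tie (A ω) T (fun n j => r n j ω) t)} := fun i =>
      (measurable_select tie T t hc hm (measurableSet_singleton i)).inter
        (measurableSet_verify tie T t hc hm)
    constructor
    · intro i
      simp_rw [count_run_succ]
      push_cast
      exact (hc i).add (Measurable.ite (hB i) measurable_const measurable_const)
    · intro i
      simp_rw [mean_run_succ]
      exact Measurable.ite (hB i)
        ((((hm i).mul (hc i)).add (hr t (by omega) i)).div ((hc i).add_const 1)) (hm i)

theorem measurable_action {t : ℕ} (hr : ∀ s < t, ∀ j, Measurable (r s j)) :
    Measurable fun ω => action tie (A ω) T (fun n j => r n j ω) t :=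
  measurable_select tie T t (measurable_count_mean_run tie A T hr).1
    (measurable_count_mean_run tie A T hr).2

theorem measurableSet_action_eq_and_verify {t : ℕ} (hr : ∀ s < t, ∀ j, Measurable (r s j))
    (i : Fin K) :
    MeasurableSet {ω | action tie (A ω) T (fun n j => r n j ω) t = i ∧
        Verify tie T t (run tie (A ω) T (fun n j => r n j ω) t)} :=
  (measurable_action tie A T hr (measurableSet_singleton i)).inter
    (measurableSet_verify tie T t (measurable_count_mean_run tie A T hr).1
      (measurable_count_mean_run tie A T hr).2)

end RunMeasurability

end SecureUCB

/-! ### Independence of the past and the probability of concentration -/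

section Bandit

variable {Ω : Type*} {K : ℕ} {r : ℕ → Fin K → Ω → ℝ}

/-- The σ-algebra generated by the rewards of all arms before round `t`. -/
@[reducible]
def pastRewards (r : ℕ → Fin K → Ω → ℝ) (t : ℕ) : MeasurableSpace Ω :=
  ⨆ p ∈ {p : ℕ × Fin K | p.1 < t}, MeasurableSpace.comap (r p.1 p.2) inferInstance

theorem measurable_pastRewards {t s : ℕ} (hs : s < t) (j : Fin K) :
    Measurable[pastRewards r t] (r s j) :=
  measurable_iff_comap_le.2 <|
    le_iSup₂_of_le (f := fun (p : ℕ × Fin K) (_ : p ∈ {p : ℕ × Fin K | p.1 < t}) =>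
      MeasurableSpace.comap (r p.1 p.2) inferInstance) (s, j) hs le_rfl

variable [mΩ : MeasurableSpace Ω] {P : Measure Ω} {ν : Fin K → Measure ℝ}

namespace IsStochasticBandit

theorem pastRewards_le (h : IsStochasticBandit P ν r) (t : ℕ) : pastRewards r t ≤ mΩ :=
  iSup₂_le fun p _ => measurable_iff_comap_le.1 (h.measurable p.1 p.2)

theorem indep_pastRewards (h : IsStochasticBandit P ν r) (t : ℕ) (i : Fin K) :
    Indep (pastRewards r t) (MeasurableSpace.comap (r t i) inferInstance) P := by
  have hd : Disjoint {p : ℕ × Fin K | p.1 < t} {(t, i)} := by simp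
  have := indep_iSup_of_disjoint (fun p : ℕ × Fin K =>
    measurable_iff_comap_le.1 (h.measurable p.1 p.2)) h.indep hd
  rwa [iSup_singleton] at this

theorem ae_mem_Icc (h : IsStochasticBandit P ν r) (t : ℕ) (i : Fin K) :
    ∀ᵐ ω ∂P, r t i ω ∈ Icc (0 : ℝ) 1 := by
  have := h.bounded i
  rw [← h.law t i] at this
  exact ae_of_ae_map (h.measurable t i).aemeasurable this

theorem integral_eq (h : IsStochasticBandit P ν r) (t : ℕ) (i : Fin K) :
    ∫ ω, r t i ω ∂P = meanReward ν i := by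
  rw [meanReward, ← h.law t i, integral_map (h.measurable t i).aemeasurable]
  exact aestronglyMeasurable_id

theorem integral_indicator_reward (h : IsStochasticBandit P ν r) (t : ℕ) (i : Fin K) {B : Set Ω}
    (hB : MeasurableSet[pastRewards r t] B) :
    ∫ ω, B.indicator (r t i) ω ∂P = ∫ ω, B.indicator (fun _ => meanReward ν i) ω ∂P := by
  have hB' : MeasurableSet B := h.pastRewards_le t B hB
  have hf : Measurable[pastRewards r t] (B.indicator fun _ : Ω => (1 : ℝ)) :=
    Measurable.indicator (@measurable_const _ _ _ (pastRewards r t) _) hB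
  have hind : IndepFun (B.indicator fun _ : Ω => (1 : ℝ)) (r t i) P :=
    indep_of_indep_of_le_left (h.indep_pastRewards t i) (measurable_iff_comap_le.1 hf)
  have := hind.integral_fun_mul_eq_mul_integral
    (hf.mono (h.pastRewards_le t) le_rfl).aestronglyMeasurable
    (h.measurable t i).aestronglyMeasurable
  rw [h.integral_eq] at this
  calc ∫ ω, B.indicator (r t i) ω ∂P
      = ∫ ω, B.indicator (fun _ => (1 : ℝ)) ω * r t i ω ∂P := by
        congr with ω
        by_cases hω : ω ∈ B <;> simp [hω]
    _ = _ := by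
        rw [this, ← integral_mul_const]
        congr with ω
        by_cases hω : ω ∈ B <;> simp [hω]

variable [IsProbabilityMeasure P]

theorem integrable (h : IsStochasticBandit P ν r) (t : ℕ) (i : Fin K) : Integrable (r t i) P :=
  Integrable.of_mem_Icc 0 1 (h.measurable t i).aemeasurable (h.ae_mem_Icc t i)

theorem meanReward_mem_Icc (h : IsStochasticBandit P ν r) (i : Fin K) :
    meanReward ν i ∈ Icc (0 : ℝ) 1 := by
  rw [← h.integral_eq 0 i]
  constructor
  · exact integral_nonneg_of_ae ((h.ae_mem_Icc 0 i).mono fun _ hω => hω.1)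
  · calc ∫ ω, r 0 i ω ∂P ≤ ∫ _, (1 : ℝ) ∂P :=
          integral_mono_ae (h.integrable 0 i) (integrable_const _)
            ((h.ae_mem_Icc 0 i).mono fun _ hω => hω.2)
      _ = 1 := by simp

theorem gap_le_one (h : IsStochasticBandit P ν r) (best i : Fin K) : gap ν best i ≤ 1 := by
  have h1 := h.meanReward_mem_Icc best
  have h2 := h.meanReward_mem_Icc i
  unfold gap
  linarith [h1.2, h2.1]

/-- Hoeffding's lemma for a single reward. -/
theorem lintegral_exp_le_one (h : IsStochasticBandit P ν r) (t : ℕ) (i : Fin K) (l : ℝ) :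
    ∫⁻ ω, ENNReal.ofReal (Real.exp (l * (r t i ω - meanReward ν i) - l ^ 2 / 8)) ∂P ≤ 1 := by
  have hsub := hasSubgaussianMGF_of_mem_Icc (h.measurable t i).aemeasurable (h.ae_mem_Icc t i)
  rw [h.integral_eq t i] at hsub
  have hint := (hsub.integrable_exp_mul l).div_const (Real.exp (l ^ 2 / 8))
  have hle := hsub.mgf_le l
  simp_rw [Real.exp_sub]
  rw [← ofReal_integral_eq_lintegral_ofReal hint (ae_of_all _ fun _ => by positivity),
    integral_div, ENNReal.ofReal_le_one, div_le_one (Real.exp_pos _)]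
  refine hle.trans (le_of_eq ?_)
  congr 1
  simp
  ring

end IsStochasticBandit

namespace SecureUCB

variable (tie : TieBreak K) (A : Ω → AttackStrategy K) (T : ℕ)

/-- The exponential supermartingale of the verified rewards of arm `i`. -/
theorem lintegral_exp_run_le_one [IsProbabilityMeasure P] (h : IsStochasticBandit P ν r)
    (i : Fin K) (l : ℝ) (t : ℕ) :
    ∫⁻ ω, ENNReal.ofReal (Real.exp
      (l * ((run tie (A ω) T (fun n j => r n j ω) t).count i *
          ((run tie (A ω) T (fun n j => r n j ω) t).mean i - meanReward ν i))
        - l ^ 2 / 8 * (run tie (A ω) T (fun n j => r n j ω) t).count i)) ∂P ≤ 1 := by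
  induction t with
  | zero => simp [run, init]
  | succ t ih =>
    set M : Ω → ENNReal := fun ω => ENNReal.ofReal (Real.exp
      (l * ((run tie (A ω) T (fun n j => r n j ω) t).count i *
          ((run tie (A ω) T (fun n j => r n j ω) t).mean i - meanReward ν i))
        - l ^ 2 / 8 * (run tie (A ω) T (fun n j => r n j ω) t).count i)) with hMdef
    set B : Set Ω := {ω | action tie (A ω) T (fun n j => r n j ω) t = i ∧
        Verify tie T t (run tie (A ω) T (fun n j => r n j ω) t)} with hBdef
    set g : Ω → ENNReal := fun ω =>
      ENNReal.ofReal (Real.exp (l * (r t i ω - meanReward ν i) - l ^ 2 / 8)) with hgdef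
    have hpast : ∀ s < t, ∀ j, Measurable[pastRewards r t] (r s j) :=
      fun s hs j => measurable_pastRewards hs j
    have hB : MeasurableSet[pastRewards r t] B :=
      @measurableSet_action_eq_and_verify _ (pastRewards r t) _ tie A T r t hpast i
    have hM : Measurable[pastRewards r t] M := by
      obtain ⟨hc, hm⟩ := @measurable_count_mean_run _ (pastRewards r t) _ tie A T r t hpast
      let _ := pastRewards r t
      exact (((((hc i).mul ((hm i).sub_const _)).const_mul l).sub
        ((hc i).const_mul _)).exp).ennreal_ofReal
    have hg : Measurable[MeasurableSpace.comap (r t i) inferInstance] g := by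
      have hr : Measurable[MeasurableSpace.comap (r t i) inferInstance] (r t i) :=
        comap_measurable _
      let _ := MeasurableSpace.comap (r t i) inferInstance
      exact ((((hr.sub_const _).const_mul l).sub_const _).exp).ennreal_ofReal
    have hle := h.pastRewards_le t
    have hBM : Measurable[pastRewards r t] (B.indicator M) := hM.indicator hB
    -- Count times mean is the sum of the verified rewards: a round in `B` multiplies `M` by `g`,
    -- any other leaves `M` unchanged. Both `M` and `B` depend on the past only, and `g` is
    -- independent of it.
    have hstep : ∀ ω, ENNReal.ofReal (Real.exp
      (l * ((run tie (A ω) T (fun n j => r n j ω) (t + 1)).count i *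
          ((run tie (A ω) T (fun n j => r n j ω) (t + 1)).mean i - meanReward ν i))
        - l ^ 2 / 8 * (run tie (A ω) T (fun n j => r n j ω) (t + 1)).count i))
        = Bᶜ.indicator M ω + B.indicator M ω * g ω := by
      intro ω
      rw [count_run_succ, mean_run_succ]
      by_cases hω : ω ∈ B
      · have hω' : _ ∧ _ := hω
        rw [if_pos hω', if_pos hω', Set.indicator_of_notMem (by simpa using hω),
          Set.indicator_of_mem hω, zero_add, hMdef, hgdef, ← ENNReal.ofReal_mul (by positivity),
          ← Real.exp_add]
        congr 2
        have : ((run tie (A ω) T (fun n j => r n j ω) t).count i : ℝ) + 1 ≠ 0 := by positivity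
        push_cast
        field_simp
        ring
      · have hω' : ¬(_ ∧ _) := hω
        rw [if_neg hω', if_neg hω', Set.indicator_of_mem (by simpa using hω),
          Set.indicator_of_notMem hω, zero_mul, add_zero, add_zero]
    simp_rw [hstep]
    rw [lintegral_add_left ((hM.mono hle le_rfl).indicator (hle B hB).compl),
      lintegral_mul_eq_lintegral_mul_lintegral_of_independent_measurableSpace hle
        (measurable_iff_comap_le.1 (h.measurable t i)) (h.indep_pastRewards t i) hBM hg]
    calc ∫⁻ ω, Bᶜ.indicator M ω ∂P + (∫⁻ ω, B.indicator M ω ∂P) * ∫⁻ ω, g ω ∂P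
        ≤ ∫⁻ ω, Bᶜ.indicator M ω ∂P + (∫⁻ ω, B.indicator M ω ∂P) * 1 := by
          gcongr
          exact h.lintegral_exp_le_one t i l
      _ = ∫⁻ ω, M ω ∂P := by
          rw [mul_one, lintegral_indicator (hle B hB).compl, lintegral_indicator (hle B hB),
            add_comm, lintegral_add_compl _ (hle B hB)]
      _ ≤ 1 := ih

theorem measureReal_one_sided_le [IsProbabilityMeasure P] (h : IsStochasticBandit P ν r)
    {T : ℕ} (hT : 1 ≤ T) (i : Fin K) (t : ℕ) {n : ℕ} (hn : 0 < n) {σ : ℝ} (hσ : σ ^ 2 = 1) :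
    P.real {ω | (run tie (A ω) T (fun n j => r n j ω) t).count i = n ∧
      √(3 * Real.log T / n) ≤
        σ * ((run tie (A ω) T (fun n j => r n j ω) t).mean i - meanReward ν i)}
      ≤ ((T : ℝ) ^ 6)⁻¹ := by
  have hT0 : (0 : ℝ) < T := by exact_mod_cast hT
  have hL : 0 ≤ Real.log T := Real.log_nonneg (by exact_mod_cast hT)
  have hn0 : (0 : ℝ) < n := by exact_mod_cast hn
  obtain ⟨hc, hm⟩ := measurable_count_mean_run tie A T (t := t) fun s _ j => h.measurable s j
  set w := √(3 * Real.log T / n) with hw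
  have hw0 : 0 ≤ w := Real.sqrt_nonneg _
  have hw2 : w ^ 2 * n = 3 * Real.log T := by
    rw [hw, Real.sq_sqrt (by positivity)]
    field_simp
  -- The slope l = 4w maximizes l·n·w − l²n/8, with value 2nw² = 6 log T; this gives T⁻⁶ in Markov's
  -- inequality. The slope depends on `n`, so the count has to be fixed.
  have hM := lintegral_exp_run_le_one tie A T h i (4 * w * σ) t
  have hmeas : Measurable fun ω => ENNReal.ofReal (Real.exp
      ((4 * w * σ) * ((run tie (A ω) T (fun n j => r n j ω) t).count i *
          ((run tie (A ω) T (fun n j => r n j ω) t).mean i - meanReward ν i))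
        - (4 * w * σ) ^ 2 / 8 * (run tie (A ω) T (fun n j => r n j ω) t).count i)) :=
    (((((hc i).mul ((hm i).sub_const _)).const_mul _).sub
        ((hc i).const_mul _)).exp).ennreal_ofReal
  have hpow : (0 : ℝ) < (T : ℝ) ^ 6 := by positivity
  have hmarkov := meas_ge_le_lintegral_div (μ := P) hmeas.aemeasurable
    (ε := ENNReal.ofReal ((T : ℝ) ^ 6)) (by simpa using hT0.ne') ENNReal.ofReal_ne_top
  refine ENNReal.toReal_le_of_le_ofReal (by positivity) ((measure_mono ?_).trans
    (hmarkov.trans ?_))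
  · rintro ω ⟨hω1, hω2⟩
    refine ENNReal.ofReal_le_ofReal ?_
    rw [← Real.exp_log hpow, Real.log_pow, hω1]
    refine Real.exp_le_exp.2 ?_
    have h1 : (4 * w * n) * w ≤ (4 * w * n) *
        (σ * ((run tie (A ω) T (fun n j => r n j ω) t).mean i - meanReward ν i)) := by
      gcongr
    have h2 : (4 * w * σ) ^ 2 / 8 * n = 2 * (w ^ 2 * n) * σ ^ 2 := by ring
    rw [h2, hσ, hw2]
    push_cast
    nlinarith
  · rw [ENNReal.ofReal_inv_of_pos hpow, ← one_div]
    gcongr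

/-- Union bound over T rounds, K arms, T values of the count and two signs, each of probability at
most T⁻⁶. -/
theorem measureReal_not_concentrated_le [IsProbabilityMeasure P] (h : IsStochasticBandit P ν r)
    {T : ℕ} (hT : 1 ≤ T) :
    P.real {ω | ¬ ∀ t < T, Concentrated T (meanReward ν) (run tie (A ω) T (fun n j => r n j ω) t)}
      ≤ 2 * K / (T : ℝ) ^ 4 := by
  have hT0 : (0 : ℝ) < T := by exact_mod_cast hT
  set E : ℕ × Fin K × ℕ → ℝ → Set Ω := fun p σ =>
    {ω | 0 < p.2.2 ∧ (run tie (A ω) T (fun n j => r n j ω) p.1).count p.2.1 = p.2.2 ∧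
      √(3 * Real.log T / p.2.2) ≤ σ *
        ((run tie (A ω) T (fun n j => r n j ω) p.1).mean p.2.1 - meanReward ν p.2.1)} with hE
  have hEle : ∀ p σ, σ ^ 2 = 1 → P.real (E p σ) ≤ ((T : ℝ) ^ 6)⁻¹ := by
    intro p σ hσ
    by_cases hp : 0 < p.2.2
    · simpa [hE, hp] using measureReal_one_sided_le tie A h hT p.2.1 p.1 hp hσ
    · simp [hE, hp]
  have hsub : {ω | ¬ ∀ t < T, Concentrated T (meanReward ν)
      (run tie (A ω) T (fun n j => r n j ω) t)} ⊆
      ⋃ p ∈ Finset.range T ×ˢ (Finset.univ : Finset (Fin K)) ×ˢ Finset.range T,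
        (E p 1 ∪ E p (-1)) := by
    intro ω hω
    simp only [Set.mem_ofPred_eq, not_forall, Concentrated, not_le] at hω
    obtain ⟨t, ht, i, hi, hlt⟩ := hω
    simp only [Set.mem_iUnion]
    refine ⟨(t, i, (run tie (A ω) T (fun n j => r n j ω) t).count i), ?_, ?_⟩
    · simp only [Finset.mem_product, Finset.mem_range, Finset.mem_univ, true_and]
      exact ⟨ht, (count_run_le tie (A ω) T _ t i).trans_lt ht⟩
    · rcases lt_abs.1 hlt with hlt | hlt
      · exact Or.inl ⟨hi, rfl, by simpa using hlt.le⟩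
      · exact Or.inr ⟨hi, rfl, by simpa using hlt.le⟩
  calc _ ≤ P.real (⋃ p ∈ Finset.range T ×ˢ (Finset.univ : Finset (Fin K)) ×ˢ Finset.range T,
        (E p 1 ∪ E p (-1))) :=
        measureReal_mono hsub (measure_ne_top P _)
    _ ≤ ∑ p ∈ Finset.range T ×ˢ (Finset.univ : Finset (Fin K)) ×ˢ Finset.range T,
        P.real (E p 1 ∪ E p (-1)) := measureReal_biUnion_finset_le _ _
    _ ≤ ∑ p ∈ Finset.range T ×ˢ (Finset.univ : Finset (Fin K)) ×ˢ Finset.range T,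
        2 * ((T : ℝ) ^ 6)⁻¹ := by
        gcongr with p
        have := measureReal_union_le (μ := P) (E p 1) (E p (-1))
        have := hEle p 1 (by norm_num)
        have := hEle p (-1) (by norm_num)
        linarith
    _ = 2 * K / (T : ℝ) ^ 4 := by
        simp
        field_simp

end SecureUCB

end Bandit

/-- The reward of a random arm, split according to the arm. -/
theorem reward_eq_sum_indicator {Ω : Type*} {K : ℕ} (x : ℕ → Fin K → Ω → ℝ) (a : Ω → Fin K) (t : ℕ) (ω : Ω) :
    x t (a ω) ω = ∑ i, (a ⁻¹' {i}).indicator (x t i) ω := by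
  rw [Finset.sum_eq_single (a ω)]
  · simp
  · intro i _ hi
    simp [Ne.symm hi]
  · simp

/-! ### Expectations and the regret decomposition -/

section Expectation

variable {Ω : Type*} [MeasurableSpace Ω] {P : Measure Ω} [IsProbabilityMeasure P] {K : ℕ}
  {ν : Fin K → Measure ℝ} {r : ℕ → Fin K → Ω → ℝ}

/-- A function that is at most `C` off the set `E` and at most `C + D` on it. -/
theorem integral_le_add_mul_measureReal {f : Ω → ℝ} (hf : Integrable f P) {E : Set Ω} {C D : ℝ}
    (hC : 0 ≤ C) (h1 : ∀ ω, f ω ≤ D) (h2 : ∀ ω, ω ∉ E → f ω ≤ C) :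
    ∫ ω, f ω ∂P ≤ C + D * P.real E := by
  -- `E` need not be measurable; its measurable hull has the same probability.
  have hm := measurableSet_toMeasurable P E
  have hi : Integrable ((toMeasurable P E).indicator fun _ => D) P :=
    (integrable_const D).indicator hm
  calc ∫ ω, f ω ∂P ≤ ∫ ω, (C + (toMeasurable P E).indicator (fun _ => D) ω) ∂P := by
        refine integral_mono hf ((integrable_const C).add hi) fun ω => ?_
        by_cases hω : ω ∈ toMeasurable P E
        · simpa [hω] using (h1 ω).trans (by linarith)
        · simpa [hω] using h2 ω fun h => hω (subset_toMeasurable P E h)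
    _ = C + D * P.real E := by
        rw [integral_add (integrable_const C) hi, integral_indicator_const D hm]
        simp [measureReal_def, measure_toMeasurable, mul_comm]

namespace SecureUCB

variable (tie : TieBreak K) (A : Ω → AttackStrategy K) (T : ℕ)

theorem integrable_reward_action (h : IsStochasticBandit P ν r) (t : ℕ) :
    Integrable (fun ω => r t (action tie (A ω) T (fun n j => r n j ω) t) ω) P := by
  have ha := measurable_action tie A T (t := t) fun s _ j => h.measurable s j
  have heq := reward_eq_sum_indicator r (fun ω => action tie (A ω) T (fun n j => r n j ω) t) t
  simp_rw [heq]
  exact integrable_finsetSum _ fun i _ =>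
    (h.integrable t i).indicator (ha (measurableSet_singleton i))

theorem integrable_comp_action (h : IsStochasticBandit P ν r) (t : ℕ) (g : Fin K → ℝ) :
    Integrable (fun ω => g (action tie (A ω) T (fun n j => r n j ω) t)) P := by
  have ha := measurable_action tie A T (t := t) fun s _ j => h.measurable s j
  refine Integrable.of_bound (C := ∑ i, |g i|)
    ((measurable_of_finite g).comp ha).aestronglyMeasurable (ae_of_all _ fun ω => ?_)
  exact Finset.single_le_sum (f := fun i => |g i|) (fun _ _ => abs_nonneg _) (Finset.mem_univ _)

/-- The selected arm is a function of earlier rewards, hence independent of the rewards of round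
`t`. -/
theorem integral_reward_action (h : IsStochasticBandit P ν r) (t : ℕ) :
    ∫ ω, r t (action tie (A ω) T (fun n j => r n j ω) t) ω ∂P
      = ∫ ω, meanReward ν (action tie (A ω) T (fun n j => r n j ω) t) ∂P := by
  have ha : Measurable[pastRewards r t] fun ω => action tie (A ω) T (fun n j => r n j ω) t :=
    @measurable_action _ (pastRewards r t) _ tie A T r t fun s hs j => measurable_pastRewards hs j
  have hle := h.pastRewards_le t
  have heq := reward_eq_sum_indicator r (fun ω => action tie (A ω) T (fun n j => r n j ω) t) t
  have heq' := reward_eq_sum_indicator (fun _ i _ => meanReward ν i)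
    (fun ω => action tie (A ω) T (fun n j => r n j ω) t) t
  simp_rw [heq, heq']
  have hms := fun i : Fin K => ha (measurableSet_singleton i)
  rw [integral_finsetSum _ fun i _ => (h.integrable t i).indicator (hle _ (hms i)),
    integral_finsetSum _ fun i _ => (integrable_const _).indicator (hle _ (hms i))]
  exact Finset.sum_congr rfl fun i _ => h.integral_indicator_reward t i (hms i)

theorem integrable_totalReward (h : IsStochasticBandit P ν r) :
    Integrable (fun ω => totalReward tie (A ω) T (fun t j => r t j ω)) P :=
  integrable_finsetSum _ fun t _ => integrable_reward_action tie A T h t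

theorem regret_eq (h : IsStochasticBandit P ν r) (best : Fin K) :
    T * meanReward ν best - ∫ ω, totalReward tie (A ω) T (fun t j => r t j ω) ∂P
      = ∫ ω, ∑ t ∈ Finset.range T,
          gap ν best (action tie (A ω) T (fun n j => r n j ω) t) ∂P := by
  unfold totalReward
  rw [integral_finsetSum _ fun t _ => integrable_reward_action tie A T h t,
    integral_finsetSum _ fun t _ => integrable_comp_action tie A T h t (gap ν best)]
  have : ∀ t, ∫ ω, gap ν best (action tie (A ω) T (fun n j => r n j ω) t) ∂P
      = meanReward ν best - ∫ ω, r t (action tie (A ω) T (fun n j => r n j ω) t) ω ∂P := by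
    intro t
    unfold gap
    rw [integral_sub (integrable_const _) (integrable_comp_action tie A T h t (meanReward ν)),
      integral_reward_action tie A T h t]
    simp
  simp_rw [this]
  simp

theorem integrable_count_run (h : IsStochasticBandit P ν r) (i : Fin K) :
    Integrable (fun ω => ((run tie (A ω) T (fun n j => r n j ω) T).count i : ℝ)) P := by
  refine Integrable.of_bound (C := T)
    ((measurable_count_mean_run tie A T fun s _ j => h.measurable s j).1 i).aestronglyMeasurable
    (ae_of_all _ fun ω => ?_)
  simpa using count_run_le tie (A ω) T _ T i

end SecureUCB

end Expectation

/-! ### Numerical bounds and absorption of lower-order terms -/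

section Bounds

variable {K : ℕ} {ν : Fin K → Measure ℝ} {best : Fin K} {T : ℕ}

theorem half_le_log (hT : 2 ≤ T) : 1 / 2 ≤ Real.log T := by
  have h1 : Real.log 2 ≤ Real.log T := Real.log_le_log (by norm_num) (by exact_mod_cast hT)
  have h2 := Real.log_two_gt_d9
  linarith

/-- There are K − 1 ≥ K/2 terms. The value K/4 is what the failure event costs, so one more copy of
the sum pays for it. -/
theorem le_two_mul_sum_erase (hK : 2 ≤ K) (f : Fin K → ℝ) (hf : ∀ i, i ≠ best → 1 / 2 ≤ f i) :
    K / 4 ≤ ∑ i ∈ Finset.univ.erase best, f i := by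
  have h1 : ∑ _i ∈ Finset.univ.erase best, (1 / 2 : ℝ) ≤ ∑ i ∈ Finset.univ.erase best, f i :=
    Finset.sum_le_sum fun i hi => hf i (Finset.ne_of_mem_erase hi)
  have h2 : (2 : ℝ) ≤ K := by exact_mod_cast hK
  rw [Finset.sum_const, Finset.card_erase_of_mem (Finset.mem_univ _), Finset.card_univ,
    Fintype.card_fin, nsmul_eq_mul, Nat.cast_sub (by omega)] at h1
  push_cast at h1
  linarith

theorem mul_failure_le (hT : 2 ≤ T) : (T : ℝ) * (2 * K / (T : ℝ) ^ 4) ≤ K / 4 := by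
  have hT' : (2 : ℝ) ≤ T := by exact_mod_cast hT
  have h3 : (2 : ℝ) ^ 3 ≤ (T : ℝ) ^ 3 := by gcongr
  have hK : (0 : ℝ) ≤ K := by positivity
  rw [mul_div_assoc', div_le_iff₀ (by positivity)]
  nlinarith [mul_nonneg hK (by positivity : (0 : ℝ) ≤ T)]

variable (hb : IsUniqueBest ν best) (hgap : ∀ i, gap ν best i ≤ 1) (hT : 2 ≤ T)

include hb hgap hT

theorem half_le_log_div_gap {i : Fin K} (hi : i ≠ best) : 1 / 2 ≤ Real.log T / gap ν best i := by
  have h1 := gap_pos hb hi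
  have h2 := half_le_log hT
  rw [le_div_iff₀ h1]
  linarith [hgap i]

theorem half_le_log_div_gap_sq {i : Fin K} (hi : i ≠ best) :
    1 / 2 ≤ Real.log T / gap ν best i ^ 2 := by
  have h1 := gap_pos hb hi
  have h2 := half_le_log hT
  have h3 : gap ν best i ^ 2 ≤ 1 := pow_le_one₀ h1.le (hgap i)
  rw [le_div_iff₀ (by positivity)]
  linarith

/-- The overshoot is absorbed by Δ² ≤ 1 ≤ 2 log T. -/
theorem le_mul_log_div_gap_sq {c n : ℝ} {i : Fin K} (hi : i ≠ best)
    (h : n * gap ν best i ^ 2 ≤ c * Real.log T + gap ν best i ^ 2) :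
    n ≤ (c + 2) * (Real.log T / gap ν best i ^ 2) := by
  have h1 := gap_pos hb hi
  have h2 := half_le_log hT
  have h3 : gap ν best i ^ 2 ≤ 1 := pow_le_one₀ h1.le (hgap i)
  rw [mul_div_assoc', le_div_iff₀ (by positivity)]
  linarith

namespace SecureUCB

variable {tie : TieBreak K} {A : AttackStrategy K} {x : ℕ → Fin K → ℝ}
  (hs : ∀ t < T, Concentrated T (meanReward ν) (run tie A T x t))

include hs

theorem count_run_le_of_concentrated {i : Fin K} (hi : i ≠ best) :
    (run tie A T x T).count i ≤ 486 * (Real.log T / gap ν best i ^ 2) := by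
  have := le_mul_log_div_gap_sq hb hgap hT hi (count_run_mul_gap_sq_le hb (by omega) hs)
  linarith

theorem sum_count_run_le_of_concentrated (hK : 2 ≤ K) :
    ∑ i, ((run tie A T x T).count i : ℝ)
      ≤ 5288 * ∑ i ∈ Finset.univ.erase best, Real.log T / gap ν best i ^ 2 := by
  have hne : (Finset.univ.erase best).Nonempty := by
    rw [← Finset.card_pos, Finset.card_erase_of_mem (Finset.mem_univ _), Finset.card_univ,
      Fintype.card_fin]
    omega
  obtain ⟨j, hj, hmin⟩ := (Finset.univ.erase best).exists_min_image (gap ν best) hne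
  have hj' := Finset.ne_of_mem_erase hj
  have h1 := le_mul_log_div_gap_sq hb hgap hT hj'
    (count_run_best_mul_gap_sq_le hb (by omega) hs hj' fun i hi => hmin i (by simp [hi]))
  have h2 : Real.log T / gap ν best j ^ 2
      ≤ ∑ i ∈ Finset.univ.erase best, Real.log T / gap ν best i ^ 2 :=
    Finset.single_le_sum (f := fun i => Real.log T / gap ν best i ^ 2)
      (fun i hi => le_trans (by norm_num)
        (half_le_log_div_gap_sq hb hgap hT (Finset.ne_of_mem_erase hi))) hj
  have h3 : ∑ i ∈ Finset.univ.erase best, ((run tie A T x T).count i : ℝ)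
      ≤ 486 * ∑ i ∈ Finset.univ.erase best, Real.log T / gap ν best i ^ 2 := by
    rw [Finset.mul_sum]
    exact Finset.sum_le_sum fun i hi =>
      count_run_le_of_concentrated hb hgap hT hs (Finset.ne_of_mem_erase hi)
  rw [← Finset.add_sum_erase _ _ (Finset.mem_univ best)]
  linarith

theorem sum_gap_action_le_of_concentrated :
    ∑ t ∈ Finset.range T, gap ν best (action tie A T x t)
      ≤ 486 * ∑ i ∈ Finset.univ.erase best, Real.log T / gap ν best i := by
  refine (sum_gap_action_le hb (by omega) hs).trans ?_
  rw [← Finset.add_sum_erase _ _ (Finset.mem_univ best), gap_self, mul_zero, zero_add,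
    Finset.mul_sum]
  refine Finset.sum_le_sum fun i hi => ?_
  have hi' := Finset.ne_of_mem_erase hi
  have h1 := gap_pos hb hi'
  calc ((run tie A T x T).count i : ℝ) * gap ν best i
      ≤ 486 * (Real.log T / gap ν best i ^ 2) * gap ν best i := by
        gcongr
        exact count_run_le_of_concentrated hb hgap hT hs hi'
    _ = 486 * (Real.log T / gap ν best i) := by field_simp

end SecureUCB

end Bounds

theorem theorem3 :
    ∃ c₂ c₃ c₄ : ℝ, 0 < c₂ ∧ 0 < c₃ ∧ 0 < c₄ ∧
      ∀ (Ω : Type*) [MeasurableSpace Ω] (P : Measure Ω) [IsProbabilityMeasure P]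
        (K : ℕ) (_ : 2 ≤ K) (ν : Fin K → Measure ℝ) (r : ℕ → Fin K → Ω → ℝ)
        (_ : IsStochasticBandit P ν r) (best : Fin K) (_ : IsUniqueBest ν best)
        (tie : TieBreak K) (A : Ω → AttackStrategy K) (T : ℕ) (_ : 2 ≤ T)
        (_ : c₂ * Real.log T / (⨅ i : {i : Fin K // i ≠ best}, gap ν best i ^ 2) ≤ T),
        (∀ i, Integrable
          (fun ω => (SecureUCB.numVerifications tie (A ω) T (fun t j => r t j ω) i : ℝ)) P) ∧
        ∑ i, ∫ ω, (SecureUCB.numVerifications tie (A ω) T (fun t j => r t j ω) i : ℝ) ∂P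
          ≤ c₃ * ∑ i ∈ Finset.univ.erase best, Real.log T / gap ν best i ^ 2 ∧
        Integrable (fun ω => SecureUCB.totalReward tie (A ω) T (fun t j => r t j ω)) P ∧
        T * meanReward ν best
            - ∫ ω, SecureUCB.totalReward tie (A ω) T (fun t j => r t j ω) ∂P
          ≤ c₄ * ∑ i ∈ Finset.univ.erase best, Real.log T / gap ν best i := by
  -- 5289 = (4800 + 2) + (484 + 2) + 1: optimal arm, other arms, failure event. Likewise 487 = (484
  -- + 2) + 1.
  refine ⟨1, 5289, 487, one_pos, by norm_num, by norm_num, ?_⟩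
  intro Ω _ P _ K hK ν r h best hb tie A T hT _
  have hgap := h.gap_le_one best
  have hbad := mul_le_mul_of_nonneg_left
    (SecureUCB.measureReal_not_concentrated_le tie A h (T := T) (by omega)) (Nat.cast_nonneg T)
  have hfail := mul_failure_le (K := K) hT
  simp_rw [SecureUCB.numVerifications_eq]
  refine ⟨SecureUCB.integrable_count_run tie A T h, ?_,
    SecureUCB.integrable_totalReward tie A T h, ?_⟩
  · have hS := le_two_mul_sum_erase hK (best := best) _
      fun i hi => half_le_log_div_gap_sq hb hgap hT hi
    rw [← integral_finsetSum _ fun i _ => SecureUCB.integrable_count_run tie A T h i]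
    have := integral_le_add_mul_measureReal
      (integrable_finsetSum Finset.univ fun i _ => SecureUCB.integrable_count_run tie A T h i)
      (C := 5288 * ∑ i ∈ Finset.univ.erase best, Real.log T / gap ν best i ^ 2) (D := T)
      (E := {ω | ¬ ∀ t < T, SecureUCB.Concentrated T (meanReward ν)
        (SecureUCB.run tie (A ω) T (fun n j => r n j ω) t)})
      (by linarith [Nat.cast_nonneg (α := ℝ) K])
      (fun ω => by exact_mod_cast SecureUCB.sum_count_run_le tie (A ω) T _ T)
      (fun ω hω => SecureUCB.sum_count_run_le_of_concentrated hb hgap hT (not_not.1 hω) hK)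
    linarith
  · have hS := le_two_mul_sum_erase hK (best := best) _
      fun i hi => half_le_log_div_gap hb hgap hT hi
    rw [SecureUCB.regret_eq tie A T h best]
    have := integral_le_add_mul_measureReal
      (integrable_finsetSum (Finset.range T) fun t _ =>
        SecureUCB.integrable_comp_action tie A T h t (gap ν best))
      (C := 486 * ∑ i ∈ Finset.univ.erase best, Real.log T / gap ν best i) (D := T)
      (E := {ω | ¬ ∀ t < T, SecureUCB.Concentrated T (meanReward ν)
        (SecureUCB.run tie (A ω) T (fun n j => r n j ω) t)})
      (by linarith [Nat.cast_nonneg (α := ℝ) K])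
      (fun ω => (Finset.sum_le_sum fun t _ => hgap _).trans (by simp))
      (fun ω hω => SecureUCB.sum_gap_action_le_of_concentrated hb hgap hT (not_not.1 hω))
    linarith
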